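/- Let $n\ge 0$, let $\mathbb T^n=\mathbb R^n/\mathbb Z^n$ with Haar measure $\mu$, and let $f:\mathbb T^n\to\mathbb T^n$ be a volume-preserving endomorphism, i.e. a surjective local homeomorphism with $\mu(f^{-1}(B))=\mu(B)$ for every Borel set $B\subset\mathbb T^n$. Identify $\pi_1(\mathbb T^n,y)$, for every base point $y$, with $\mathbb Z^n\subset\mathbb R^n$ by sending the class of a loop to $\Gamma(1)-\Gamma(0)$, where $\Gamma$ is any lift of the loop to $\mathbb R^n$, and let $A_f\in M_n(\mathbb Z)$ be the matrix representing the induced map $f_\#:\pi_1(\mathbb T^n)\to\pi_1(\mathbb T^n)$ on $\mathbb Z^n$. Let $U\subset\mathbb T^n$ be a connected (in particular non-empty) invariant region for $f$, i.e. a connected open set with $f^{-1}(U)=U$, let $i:U\to\mathbb T^n$ be the inclusion, and let $S\subset\mathbb R^n$ be the real linear subspace spanned by $i_\#(\pi_1(U,x))\subset\mathbb Z^n$, where $x\in U$ is any base point. Then $A_f(S)\subset S$, and $$|\det(A_f|_S)|=|\det A_f|,$$ where $A_f|_S:S\to S$ is the restriction of $A_f$ to $S$ (the determinant on the zero space being $1$).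 -/

import Mathlib

open MeasureTheory Topology

noncomputable section

namespace ToralEndo

/-- The torus `𝕋ⁿ = ℝⁿ / ℤⁿ` as the product of `n` copies of `ℝ / ℤ`, with the product topology and
with `volume` the product of the Haar probability measures. -/
abbrev Torus (n : ℕ) : Type := UnitAddTorus (Fin n)

/-- The inclusion `ℤⁿ → ℝⁿ`. -/
def latticeEmb (n : ℕ) : (Fin n → ℤ) →+ (Fin n → ℝ) where
  toFun m i := (m i : ℝ)
  map_zero' := by ext; simp
  map_add' _ _ := by ext; simp

/-- The translation action of `ℤⁿ` on `ℝⁿ`. -/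
@[reducible] def latticeAction (n : ℕ) : AddAction (Fin n → ℤ) (Fin n → ℝ) :=
  AddAction.compHom (Fin n → ℝ) (latticeEmb n)

/-- The natural projection `ℝⁿ → 𝕋ⁿ`. -/
def torusProj (n : ℕ) (v : Fin n → ℝ) : Torus n := fun i => (v i : UnitAddCircle)

/-- The projection `ℝⁿ → 𝕋ⁿ` is the quotient covering map of the translation action of `ℤⁿ`. -/
theorem isAddQuotientCoveringMap_torusProj (n : ℕ) :
    letI := latticeAction n
    IsAddQuotientCoveringMap (torusProj n) (Fin n → ℤ) := by
  let := latticeAction n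
  have hv : ∀ (g : Fin n → ℤ) (e : Fin n → ℝ), g +ᵥ e = latticeEmb n g + e := fun _ _ => rfl
  have hq : IsOpenQuotientMap (torusProj n) :=
    IsOpenQuotientMap.piMap (f := fun (_ : Fin n) (x : ℝ) => (x : UnitAddCircle))
      fun _ => QuotientAddGroup.isOpenQuotientMap_mk
  exact
  { toIsQuotientMap := hq.isQuotientMap
    continuous_const_vadd := fun g => by
      simp only [hv]; exact continuous_const.add continuous_id
    apply_eq_iff_mem_orbit := by
      intro e₁ e₂
      constructor
      · intro h
        have h' : ∀ i, ∃ m : ℤ, (m : ℝ) = e₁ i - e₂ i := fun i => by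
          have hi : ((e₁ i : ℝ) : UnitAddCircle) = (e₂ i : ℝ) := congrFun h i
          have h0 : ((e₁ i - e₂ i : ℝ) : UnitAddCircle) = 0 := by
            rw [AddCircle.coe_sub, hi, sub_self]
          obtain ⟨m, hm⟩ := (AddCircle.coe_eq_zero_iff (1 : ℝ)).1 h0
          exact ⟨m, by simpa using hm⟩
        choose m hm using h'
        refine ⟨m, ?_⟩
        ext i
        change (m i : ℝ) + e₂ i = e₁ i
        rw [hm i]; ring
      · rintro ⟨m, rfl⟩
        ext i
        change (((m i : ℝ) + e₂ i : ℝ) : UnitAddCircle) = (e₂ i : ℝ)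
        rw [AddCircle.coe_add]
        have : ((m i : ℝ) : UnitAddCircle) = 0 :=
          (AddCircle.coe_eq_zero_iff (1 : ℝ)).2 ⟨m i, by simp⟩
        rw [this, zero_add]
    disjoint := fun e => by
      refine ⟨Metric.ball e (1 / 2), Metric.ball_mem_nhds _ (by norm_num), fun g hg => ?_⟩
      obtain ⟨_, ⟨x, hx, rfl⟩, hy⟩ := hg
      have hd : dist (g +ᵥ x) x < 1 := by
        calc dist (g +ᵥ x) x ≤ dist (g +ᵥ x) e + dist x e := dist_triangle_right _ _ _
          _ < 1 / 2 + 1 / 2 := add_lt_add hy hx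
          _ = 1 := by norm_num
      ext i
      have hi : dist ((g i : ℝ) + x i) (x i) < 1 := (dist_le_pi_dist (g +ᵥ x) x i).trans_lt hd
      rw [Real.dist_eq, add_sub_cancel_right] at hi
      have : |g i| < 1 := by exact_mod_cast hi
      simpa using Int.abs_lt_one_iff.1 this }

/-- The canonical isomorphism `π₁(𝕋ⁿ, x) ≅ ℤⁿ`: the class of a loop is sent to the displacement
`Γ 1 - Γ 0` of any lift `Γ` of the loop to `ℝⁿ` (see `piOneEquiv_apply`). -/
def piOneEquiv {n : ℕ} (x : Torus n) : Additive (FundamentalGroup (Torus n) x) ≃+ (Fin n → ℤ) :=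
  letI := latticeAction n
  let hp := isAddQuotientCoveringMap_torusProj n
  let e : torusProj n ⁻¹' {x} := ⟨(hp.surjective x).choose, (hp.surjective x).choose_spec⟩
  ((hp.fundamentalGroupEquiv e).trans MulOpposite.opMulEquiv.symm).toAdditive.trans
    (AddEquiv.additiveMultiplicative (Fin n → ℤ))

/-- The class of a loop is sent to the displacement of any of its lifts. -/
theorem piOneEquiv_apply {n : ℕ} {x : Torus n} (γ : Path x x) (Γ : C(unitInterval, Fin n → ℝ))
    (hΓ : ∀ t, torusProj n (Γ t) = γ t) (i : Fin n) :
    (piOneEquiv x (Additive.ofMul (FundamentalGroup.fromPath ⟦γ⟧)) i : ℝ) = Γ 1 i - Γ 0 i := by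
  let := latticeAction n
  let hp := isAddQuotientCoveringMap_torusProj n
  let e : torusProj n ⁻¹' {x} := ⟨(hp.surjective x).choose, (hp.surjective x).choose_spec⟩
  have key : latticeEmb n (piOneEquiv x (Additive.ofMul (FundamentalGroup.fromPath ⟦γ⟧))) + e.1 =
      hp.isCoveringMap.monodromy ⟦γ⟧ e :=
    hp.unop_fundamentalGroupToMulOpposite_smul (e := e)
  obtain ⟨m, hm⟩ : ∃ m : Fin n → ℤ, latticeEmb n m + Γ 0 = e.1 :=
    hp.apply_eq_iff_mem_orbit.1 (e.2.trans (by rw [hΓ, γ.source]))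
  let Γ' : C(unitInterval, Fin n → ℝ) := ⟨fun t => latticeEmb n m + Γ t, by fun_prop⟩
  have hlift : Γ' = hp.isCoveringMap.liftPath γ e (γ.source.trans e.2.symm) := by
    refine (hp.isCoveringMap.eq_liftPath_iff' _).2 ⟨?_, hm⟩
    ext t : 1
    exact (hp.map_vadd m).trans (hΓ t)
  have hmon : (hp.isCoveringMap.monodromy ⟦γ⟧ e : Fin n → ℝ) = latticeEmb n m + Γ 1 :=
    (congrArg (fun G : C(unitInterval, Fin n → ℝ) => G 1) hlift).symm
  have := congrFun (key.trans hmon) i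
  rw [← hm] at this
  simp only [Pi.add_apply] at this
  change (_ : ℝ) + (_ + _) = _ at this
  change latticeEmb n _ i = _
  linarith

/-- A toral endomorphism: a surjective local homeomorphism of the torus. -/
def IsToralEndomorphism {n : ℕ} (f : C(Torus n, Torus n)) : Prop :=
  IsLocalHomeomorph f ∧ Function.Surjective f

/-- `f` preserves Haar measure: `μ (f⁻¹ B) = μ B` for every Borel set `B`. -/
def IsVolumePreserving {n : ℕ} (f : C(Torus n, Torus n)) : Prop :=
  ∀ B : Set (Torus n), MeasurableSet B → volume (f ⁻¹' B) = volume B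

/-- An invariant region: an open set `U` with `f⁻¹ U = U`. -/
structure IsInvariantRegion {n : ℕ} (f : C(Torus n, Torus n)) (U : Set (Torus n)) : Prop where
  isOpen : IsOpen U
  preimage_eq : f ⁻¹' U = U

/-- The map `f_# : ℤⁿ ≅ π₁(𝕋ⁿ, 0) → π₁(𝕋ⁿ, f 0) ≅ ℤⁿ` induced by `f`. -/
def piOneMap {n : ℕ} (f : C(Torus n, Torus n)) : (Fin n → ℤ) →+ (Fin n → ℤ) :=
  (piOneEquiv (f 0)).toAddMonoidHom.comp
    ((MonoidHom.toAdditive (FundamentalGroup.map f 0)).comp (piOneEquiv 0).symm.toAddMonoidHom)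

/-- The linear part `A_f` of `f`: the integer matrix representing `f_#` in the standard basis. -/
def linearPart {n : ℕ} (f : C(Torus n, Torus n)) : Matrix (Fin n) (Fin n) ℤ :=
  LinearMap.toMatrix' (piOneMap f).toIntLinearMap

/-- The linear map of `ℝⁿ` defined by `A_f`. -/
def linearPartReal {n : ℕ} (f : C(Torus n, Torus n)) : (Fin n → ℝ) →ₗ[ℝ] (Fin n → ℝ) :=
  Matrix.toLin' ((linearPart f).map (Int.cast : ℤ → ℝ))

/-- The map `i_# : π₁(U, x) → π₁(𝕋ⁿ, x) ≅ ℤⁿ` induced by the inclusion `i : U → 𝕋ⁿ`. -/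
def inclPiOne {n : ℕ} (U : Set (Torus n)) (x : U) :
    Additive (FundamentalGroup U x) →+ (Fin n → ℤ) :=
  (piOneEquiv (x : Torus n)).toAddMonoidHom.comp
    (MonoidHom.toAdditive
      (FundamentalGroup.map (⟨Subtype.val, continuous_subtype_val⟩ : C(U, Torus n)) x))

/-- The real subspace of `ℝⁿ` spanned by `i_# (π₁(U, x)) ⊆ ℤⁿ ⊆ ℝⁿ`. -/
def piOneSpan {n : ℕ} (U : Set (Torus n)) (x : U) : Submodule ℝ (Fin n → ℝ) :=
  Submodule.span ℝ (Set.range fun c => latticeEmb n (inclPiOne U x c))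

end ToralEndo

end

/-! ### The universal covering of the torus -/

namespace ToralEndo

open unitInterval Pointwise

variable {n : ℕ}

/-! Lift `f` to `F : ℝⁿ → ℝⁿ` with `F (v + m) = F v + A m` for `m ∈ ℤⁿ`. Let `Ũ` be the preimage of
`U` in `ℝⁿ`. As `U` is connected, `ℤⁿ` permutes the path components of `Ũ` transitively, and `H =
i_# π₁(U)` is the common stabilizer of these components. Since `F` maps `Ũ` to itself, `A H ⊆ H`.
Since `F` is onto and `F⁻¹ Ũ = Ũ`, `A` is surjective on `ℤⁿ / H`
(`exists_sub_piOneMap_mem_range_inclPiOne`).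

The rest is algebra (`abs_det_restrict_span_eq`). With `N = S ∩ ℤⁿ ⊇ H`, the quotient `ℤⁿ / N` is
free of finite rank, so the surjection induced on it is an automorphism, of determinant `±1`. Its
real extension is the map induced by `A` on `ℝⁿ / S`, and `det A` is the product of the determinants
on `S` and on `ℝⁿ / S`. -/

theorem torusProj_add_latticeEmb (v : Fin n → ℝ) (m : Fin n → ℤ) :
    torusProj n (v + latticeEmb n m) = torusProj n v := by
  let := latticeAction n
  rw [add_comm]
  exact (isAddQuotientCoveringMap_torusProj n).map_vadd m

theorem exists_eq_add_latticeEmb {v w : Fin n → ℝ} (h : torusProj n v = torusProj n w) :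
    ∃ m, w = v + latticeEmb n m := by
  let := latticeAction n
  obtain ⟨m, hm⟩ := (isAddQuotientCoveringMap_torusProj n).apply_eq_iff_mem_orbit.1 h.symm
  exact ⟨m, by rw [add_comm]; exact hm.symm⟩

theorem isCoveringMap_torusProj (n : ℕ) : IsCoveringMap (torusProj n) :=
  let := latticeAction n
  (isAddQuotientCoveringMap_torusProj n).isCoveringMap

theorem isQuotientMap_torusProj (n : ℕ) : IsQuotientMap (torusProj n) :=
  let := latticeAction n
  (isAddQuotientCoveringMap_torusProj n).toIsQuotientMap

theorem continuous_torusProj (n : ℕ) : Continuous (torusProj n) :=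
  (isQuotientMap_torusProj n).continuous

theorem isClosedEmbedding_latticeEmb (n : ℕ) : IsClosedEmbedding (latticeEmb n) where
  toIsEmbedding := .piMap fun _ => Int.isClosedEmbedding_coe_real.isEmbedding
  isClosed_range := by
    have : Set.range (latticeEmb n) = Set.univ.pi fun _ => Set.range ((↑) : ℤ → ℝ) :=
      Set.range_piMap fun _ => ((↑) : ℤ → ℝ)
    rw [this]
    exact isClosed_set_pi fun _ _ => Int.isClosedEmbedding_coe_real.isClosed_range

instance (n : ℕ) : LocallyPathConnectedSpace (Torus n) :=
  (isQuotientMap_torusProj n).locallyPathConnectedSpace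

theorem exists_lift (f : C(Torus n, Torus n)) :
    ∃ F : C(Fin n → ℝ, Fin n → ℝ), ∀ v, torusProj n (F v) = f (torusProj n v) := by
  obtain ⟨e, he⟩ := (isQuotientMap_torusProj n).surjective (f (torusProj n 0))
  obtain ⟨F, ⟨-, hF⟩, -⟩ := (isCoveringMap_torusProj n).existsUnique_continuousMap_lifts
    (f.comp ⟨torusProj n, continuous_torusProj n⟩) 0 e he
  exact ⟨F, congrFun hF⟩

theorem piOneEquiv_eq_of_lift {x : Torus n} (γ : Path x x) (Γ : C(I, Fin n → ℝ))
    (hΓ : ∀ t, torusProj n (Γ t) = γ t) {m : Fin n → ℤ} (hm : Γ 1 = Γ 0 + latticeEmb n m) :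
    piOneEquiv x (Additive.ofMul (FundamentalGroup.fromPath ⟦γ⟧)) = m := by
  ext i
  have h := piOneEquiv_apply γ Γ hΓ i
  have hi : Γ 1 i = Γ 0 i + (m i : ℝ) := congrFun hm i
  rw [hi, add_sub_cancel_left] at h
  exact_mod_cast h

theorem latticeEmb_piOneEquiv {x : Torus n} (γ : Path x x) (Γ : C(I, Fin n → ℝ))
    (hΓ : ∀ t, torusProj n (Γ t) = γ t) :
    Γ 0 + latticeEmb n (piOneEquiv x (Additive.ofMul (FundamentalGroup.fromPath ⟦γ⟧))) = Γ 1 := by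
  ext i
  have h := piOneEquiv_apply γ Γ hΓ i
  change Γ 0 i + _ = _
  change (latticeEmb n _ i : ℝ) = _ at h
  rw [h]; ring

/-! ### Equivariance and surjectivity of the lift -/

section Lift

variable {f : C(Torus n, Torus n)} {F : C(Fin n → ℝ, Fin n → ℝ)}
  (hF : ∀ v, torusProj n (F v) = f (torusProj n v))
include hF

/-- The segment from `0` to `m` projects to a loop of class `m`, and its image under `F` lifts the
image loop. -/
theorem lift_latticeEmb (m : Fin n → ℤ) :
    F (latticeEmb n m) = F 0 + latticeEmb n (piOneMap f m) := by
  let Γ : C(I, Fin n → ℝ) := ⟨fun t => (t : ℝ) • latticeEmb n m, by fun_prop⟩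
  have h0 : Γ 0 = 0 := by simp [Γ]
  have h1 : Γ 1 = latticeEmb n m := by simp [Γ]
  have hp0 : torusProj n 0 = 0 := rfl
  let γ : Path (0 : Torus n) 0 :=
    { toFun := fun t => torusProj n (Γ t)
      continuous_toFun := (continuous_torusProj n).comp Γ.continuous
      source' := by rw [h0, hp0]
      target' := by rw [h1, ← zero_add (latticeEmb n m), torusProj_add_latticeEmb, hp0] }
  have hm : piOneEquiv (0 : Torus n) (Additive.ofMul (FundamentalGroup.fromPath ⟦γ⟧)) = m :=
    piOneEquiv_eq_of_lift γ Γ (fun _ => rfl) (by rw [h0, h1, zero_add])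
  have hm' : (piOneEquiv (0 : Torus n)).symm m =
      Additive.ofMul (FundamentalGroup.fromPath ⟦γ⟧) := by
    rw [AddEquiv.symm_apply_eq, hm]
  have hA : piOneMap f m = piOneEquiv (f 0)
      (Additive.ofMul (FundamentalGroup.fromPath ⟦γ.map f.continuous⟧)) := by
    change piOneEquiv (f 0) (MonoidHom.toAdditive (FundamentalGroup.map f 0)
      ((piOneEquiv (0 : Torus n)).symm m)) = _
    rw [hm']; rfl
  have := latticeEmb_piOneEquiv (γ.map f.continuous) (F.comp Γ) (fun t => hF (Γ t))
  rw [← hA] at this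
  simpa [h0, h1] using this.symm

/-- The displacement `F (v + m) - F v` is a continuous function of `v` with values in the discrete
lattice, hence constant; its value is read off at `v = 0`. -/
theorem lift_add_latticeEmb (v : Fin n → ℝ) (m : Fin n → ℤ) :
    F (v + latticeEmb n m) = F v + latticeEmb n (piOneMap f m) := by
  have h : ∀ v, ∃ k, F (v + latticeEmb n m) = F v + latticeEmb n k := fun v =>
    exists_eq_add_latticeEmb (by rw [hF, hF, torusProj_add_latticeEmb])
  choose k hk using h
  have hc : Continuous k := by
    rw [(isClosedEmbedding_latticeEmb n).isInducing.continuous_iff]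
    have : latticeEmb n ∘ k = fun v => F (v + latticeEmb n m) - F v := by
      ext1 v; simp [hk]
    rw [this]
    fun_prop
  have h0 := hk 0
  rw [zero_add, lift_latticeEmb hF, add_right_inj] at h0
  rw [hk, PreconnectedSpace.constant inferInstance hc (x := v) (y := 0),
    (isClosedEmbedding_latticeEmb n).injective h0]

/-- The range is open because `F` is a local homeomorphism. By equivariance it is the sum of the
compact image of the unit cube and a closed set of lattice points, hence closed. -/
theorem lift_surjective (hf : IsLocalHomeomorph f) : Function.Surjective F := by
  have hloc : IsLocalHomeomorph F := by
    refine IsLocalHomeomorph.of_comp (g := torusProj n) ?_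
      (isCoveringMap_torusProj n).isLocalHomeomorph F.continuous
    have : torusProj n ∘ F = f ∘ torusProj n := funext hF
    rw [this]
    exact hf.comp (isCoveringMap_torusProj n).isLocalHomeomorph
  have hopen : IsOpen (Set.range F) := hloc.isOpenMap.isOpen_range
  have hrange : Set.range F =
      F '' Set.Icc 0 1 + latticeEmb n '' Set.range (piOneMap f) := by
    apply subset_antisymm
    · rintro _ ⟨v, rfl⟩
      have hv : v = (fun i => Int.fract (v i)) + latticeEmb n (fun i => ⌊v i⌋) := by
        ext i; exact (Int.fract_add_floor (v i)).symm
      rw [hv, lift_add_latticeEmb hF]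
      exact Set.add_mem_add (Set.mem_image_of_mem _ ⟨fun i => Int.fract_nonneg _,
        fun i => (Int.fract_lt_one _).le⟩) ⟨_, ⟨_, rfl⟩, rfl⟩
    · rintro _ ⟨_, ⟨v, -, rfl⟩, _, ⟨_, ⟨m, rfl⟩, rfl⟩, rfl⟩
      exact ⟨_, lift_add_latticeEmb hF v m⟩
  have hclosed : IsClosed (Set.range F) := by
    rw [hrange]
    exact ((isClosedEmbedding_latticeEmb n).isClosedMap _ (isClosed_discrete _)).add_left_of_isCompact
      (isCompact_Icc.image F.continuous)
  exact Set.range_eq_univ.1 (IsClopen.eq_univ ⟨hclosed, hopen⟩ (Set.range_nonempty F))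

end Lift

/-! ### Path components over an invariant region -/

section Region

variable {U : Set (Torus n)}

theorem exists_joinedIn_add_latticeEmb (hU : IsOpen U) (hconn : IsConnected U)
    {v w : Fin n → ℝ} (hv : torusProj n v ∈ U) (hw : torusProj n w ∈ U) :
    ∃ k, JoinedIn (torusProj n ⁻¹' U) v (w + latticeEmb n k) := by
  obtain ⟨γ, hγ⟩ := (hU.isConnected_iff_isPathConnected.1 hconn).joinedIn _ hv _ hw
  obtain ⟨Γ, hΓ, hΓ0⟩ := (isCoveringMap_torusProj n).exists_path_lifts γ v γ.source
  have hΓ' : ∀ t, torusProj n (Γ t) = γ t := congrFun hΓ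
  obtain ⟨k, hk⟩ := exists_eq_add_latticeEmb (v := w) (w := Γ 1) (by rw [hΓ', γ.target])
  exact ⟨k, ⟨Γ, hΓ0, hk⟩, fun t => by
    change torusProj n (Γ t) ∈ U
    rw [hΓ']; exact hγ t⟩

theorem joinedIn_add_latticeEmb {v w : Fin n → ℝ} (h : JoinedIn (torusProj n ⁻¹' U) v w)
    (k : Fin n → ℤ) :
    JoinedIn (torusProj n ⁻¹' U) (v + latticeEmb n k) (w + latticeEmb n k) := by
  obtain ⟨γ, hγ⟩ := h
  refine ⟨γ.map (f := (· + latticeEmb n k)) (by fun_prop), fun t => ?_⟩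
  change torusProj n (γ t + latticeEmb n k) ∈ U
  rw [torusProj_add_latticeEmb]
  exact hγ t

/-- Components over `U` are translates of one another, and the translation group is abelian, so they
have the same stabilizer. -/
theorem joinedIn_add_latticeEmb_of_mem (hU : IsOpen U) (hconn : IsConnected U)
    {v w : Fin n → ℝ} (hv : torusProj n v ∈ U) (hw : torusProj n w ∈ U) {m : Fin n → ℤ}
    (h : JoinedIn (torusProj n ⁻¹' U) v (v + latticeEmb n m)) :
    JoinedIn (torusProj n ⁻¹' U) w (w + latticeEmb n m) := by
  obtain ⟨k, hk⟩ := exists_joinedIn_add_latticeEmb hU hconn hw hv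
  refine (hk.trans (joinedIn_add_latticeEmb h k)).trans ?_
  have := (joinedIn_add_latticeEmb hk m).symm
  rwa [add_right_comm] at this

/-- Lifting loops identifies `i_# π₁(U, x)` with the stabilizer of the component of `v`. -/
theorem mem_range_inclPiOne_iff {x : U} {v : Fin n → ℝ} (hv : torusProj n v = x)
    {m : Fin n → ℤ} :
    m ∈ Set.range (inclPiOne U x) ↔ JoinedIn (torusProj n ⁻¹' U) v (v + latticeEmb n m) := by
  constructor
  · rintro ⟨c, rfl⟩
    obtain ⟨γ, rfl⟩ : ∃ γ : Path x x, Additive.ofMul (FundamentalGroup.fromPath ⟦γ⟧) = c := by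
      obtain ⟨γ, hγ⟩ := Quotient.exists_rep (FundamentalGroup.toPath c.toMul)
      exact ⟨γ, by rw [hγ]; rfl⟩
    let γ' : Path (x : Torus n) x := γ.map continuous_subtype_val
    obtain ⟨Γ, hΓ, hΓ0⟩ := (isCoveringMap_torusProj n).exists_path_lifts γ' v
      (γ'.source.trans hv.symm)
    have hΓ' : ∀ t, torusProj n (Γ t) = γ' t := congrFun hΓ
    refine ⟨⟨Γ, hΓ0, ?_⟩, fun t => ?_⟩
    · have := latticeEmb_piOneEquiv γ' Γ hΓ'
      rw [hΓ0] at this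
      exact this.symm
    · change torusProj n (Γ t) ∈ U
      rw [hΓ']
      exact (γ t).2
  · rintro ⟨Γ, hΓ⟩
    let γ : Path x x :=
      { toFun := fun t => ⟨torusProj n (Γ t), hΓ t⟩
        continuous_toFun := ((continuous_torusProj n).comp Γ.continuous).subtype_mk _
        source' := Subtype.ext (by simp [hv])
        target' := Subtype.ext (by simp [torusProj_add_latticeEmb, hv]) }
    refine ⟨Additive.ofMul (FundamentalGroup.fromPath ⟦γ⟧), ?_⟩
    exact piOneEquiv_eq_of_lift (γ.map continuous_subtype_val) Γ.toContinuousMap (fun _ => rfl)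
      (by simp)

variable {f : C(Torus n, Torus n)}

theorem piOneMap_mem_range_inclPiOne (hU : IsInvariantRegion f U) (hconn : IsConnected U) (x : U)
    {m : Fin n → ℤ} (hm : m ∈ (inclPiOne U x).range) : piOneMap f m ∈ (inclPiOne U x).range := by
  obtain ⟨v, hv⟩ := (isQuotientMap_torusProj n).surjective x
  obtain ⟨F, hF⟩ := exists_lift f
  have hvU : torusProj n v ∈ U := hv ▸ x.2
  have hFU : ∀ w, torusProj n w ∈ U → torusProj n (F w) ∈ U := fun w hw => by
    rw [← hU.preimage_eq] at hw
    rw [hF]; exact hw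
  obtain ⟨γ, hγ⟩ := (mem_range_inclPiOne_iff hv).1 hm
  refine (mem_range_inclPiOne_iff hv).2
    (joinedIn_add_latticeEmb_of_mem hU.isOpen hconn (hFU v hvU) hvU ?_)
  rw [← lift_add_latticeEmb hF]
  exact ⟨γ.map F.continuous, fun t => hFU _ (hγ t)⟩

/-- Pull `v` and `v + m` back through `F`. The two preimages lie over `U`, so they can be joined
there after a lattice translation of one of them; `F` carries the path back over `U`. -/
theorem exists_sub_piOneMap_mem_range_inclPiOne (hf : IsLocalHomeomorph f)
    (hU : IsInvariantRegion f U) (hconn : IsConnected U) (x : U) (m : Fin n → ℤ) :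
    ∃ k, m - piOneMap f k ∈ (inclPiOne U x).range := by
  obtain ⟨v, hv⟩ := (isQuotientMap_torusProj n).surjective x
  obtain ⟨F, hF⟩ := exists_lift f
  have hvU : torusProj n v ∈ U := hv ▸ x.2
  have hFU : ∀ w, torusProj n (F w) ∈ U ↔ torusProj n w ∈ U := fun w => by
    rw [hF]
    exact Set.ext_iff.1 hU.preimage_eq (torusProj n w)
  obtain ⟨u, hu⟩ := lift_surjective hF hf v
  obtain ⟨w, hw⟩ := lift_surjective hF hf (v + latticeEmb n m)
  obtain ⟨k, γ, hγ⟩ := exists_joinedIn_add_latticeEmb hU.isOpen hconn (v := u) (w := w)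
    ((hFU _).1 (by rwa [hu])) ((hFU _).1 (by rwa [hw, torusProj_add_latticeEmb]))
  -- The image path runs from `v` to `v + (m + A k)`, and `m + A k = m - A (-k)`.
  refine ⟨-k, (mem_range_inclPiOne_iff hv).2 ?_⟩
  have hj : JoinedIn (torusProj n ⁻¹' U) (F u) (F (w + latticeEmb n k)) :=
    ⟨γ.map F.continuous, fun t => (hFU _).2 (hγ t)⟩
  rw [lift_add_latticeEmb hF, hu, hw, add_assoc, ← map_add] at hj
  simpa using hj

end Region

end ToralEndo

/-! ### Determinants on the quotient by the span -/

/-- Checked by the universal property: a map out of `M ⧸ N` is a map out of `M` killing `N`, and its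
extension to `V` then kills the span `W`. -/
theorem IsBaseChange.quotient_span {R S M V : Type*} [CommRing R] [CommRing S] [Algebra R S]
    [AddCommGroup M] [Module R M] [AddCommGroup V] [Module R V] [Module S V] [IsScalarTower R S V]
    {ε : M →ₗ[R] V} (hε : IsBaseChange S ε) (N : Submodule R M) (W : Submodule S V)
    (hW : W = Submodule.span S (ε '' N)) (hN : N ≤ (W.mkQ.restrictScalars R ∘ₗ ε).ker) :
    IsBaseChange S (N.liftQ (W.mkQ.restrictScalars R ∘ₗ ε) hN) := by
  refine IsBaseChange.of_lift_unique _ fun Q _ _ _ _ g => ?_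
  let : AddCommGroup Q := Module.addCommMonoidToAddCommGroup S
  have hker : W ≤ (hε.lift (g ∘ₗ N.mkQ)).ker := by
    rw [hW, Submodule.span_le]
    rintro _ ⟨m, hm, rfl⟩
    change hε.lift (g ∘ₗ N.mkQ) (ε m) = 0
    rw [hε.lift_eq, LinearMap.comp_apply, Submodule.mkQ_apply,
      (Submodule.Quotient.mk_eq_zero N).2 hm, map_zero]
  refine ⟨W.liftQ _ hker, ?_, fun g' hg' => ?_⟩
  · refine Submodule.linearMap_qext _ (LinearMap.ext fun m => ?_)
    exact hε.lift_eq _ m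
  · refine Submodule.linearMap_qext _ (hε.algHom_ext _ _ fun m => ?_)
    refine (LinearMap.congr_fun hg' (N.mkQ m)).trans ?_
    exact (hε.lift_eq (g ∘ₗ N.mkQ) m).symm

/-- If an endomorphism of a finite `ℤ`-module `M` becomes surjective modulo a submodule `H`, then its
real extension has, on the real span of `H`, the same determinant up to sign. -/
theorem abs_det_restrict_span_eq {M V : Type*} [AddCommGroup M] [Module.Finite ℤ M]
    [AddCommGroup V] [Module ℝ V] [FiniteDimensional ℝ V] {ε : M →ₗ[ℤ] V}
    (hε : IsBaseChange ℝ ε) (a : M →ₗ[ℤ] M) (A : V →ₗ[ℝ] V) (hA : ∀ m, A (ε m) = ε (a m))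
    (H : AddSubgroup M) (hH : ∀ m ∈ H, a m ∈ H) (hsurj : ∀ m, ∃ k, m - a k ∈ H) :
    ∃ hS : ∀ v ∈ Submodule.span ℝ (ε '' H), A v ∈ Submodule.span ℝ (ε '' H),
      |LinearMap.det (A.restrict hS)| = |LinearMap.det A| := by
  set S := Submodule.span ℝ (ε '' H) with hSdef
  have hS : S ≤ S.comap A := by
    rw [hSdef, Submodule.span_le]
    rintro _ ⟨m, hm, rfl⟩
    change A (ε m) ∈ Submodule.span ℝ (ε '' H)
    rw [hA]
    exact Submodule.subset_span ⟨_, hH m hm, rfl⟩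
  refine ⟨hS, ?_⟩
  -- `N` saturates `H`: it has the same real span, but the quotient by it has no torsion, since `S`
  -- is closed under division by nonzero integers.
  let N : Submodule ℤ M := (S.restrictScalars ℤ).comap ε
  have hHN : ∀ m ∈ H, m ∈ N := fun m hm => Submodule.subset_span ⟨m, hm, rfl⟩
  have hSN : S = Submodule.span ℝ (ε '' N) := by
    refine le_antisymm (Submodule.span_mono (Set.image_mono hHN)) ?_
    rw [Submodule.span_le]
    rintro _ ⟨m, hm, rfl⟩
    exact hm
  have ha : N ≤ N.comap a := fun m hm => by
    change ε (a m) ∈ S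
    rw [← hA]
    exact hS hm
  have hker : N ≤ (S.mkQ.restrictScalars ℤ ∘ₗ ε).ker := fun m hm =>
    (Submodule.Quotient.mk_eq_zero S).2 hm
  have hbc := hε.quotient_span N S hSN hker
  have : Module.IsTorsionFree ℤ (M ⧸ N) := by
    refine Module.isTorsionFree_iff_smul_eq_zero.2 fun k x hx => ?_
    obtain ⟨m, rfl⟩ := N.mkQ_surjective x
    rw [or_iff_not_imp_left]
    intro hk
    rw [← map_smul, Submodule.mkQ_apply, Submodule.Quotient.mk_eq_zero] at hx
    refine (Submodule.Quotient.mk_eq_zero N).2 ?_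
    have hkm : (k : ℝ) • ε m ∈ S := by
      rw [Int.cast_smul_eq_zsmul, ← map_zsmul]
      exact hx
    exact (S.smul_mem_iff (Int.cast_ne_zero.2 hk)).1 hkm
  have : Module.Free ℤ (M ⧸ N) := Module.free_of_finite_type_torsion_free'
  -- A surjective endomorphism of a finite module is injective.
  have hbij : Function.Bijective (N.mapQ N a ha) := by
    refine OrzechProperty.bijective_of_surjective_endomorphism _ fun x => ?_
    obtain ⟨m, rfl⟩ := N.mkQ_surjective x
    obtain ⟨k, hk⟩ := hsurj m
    refine ⟨N.mkQ k, ?_⟩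
    exact ((Submodule.Quotient.eq N).2 (hHN _ hk)).symm
  have hunit : IsUnit (LinearMap.det (N.mapQ N a ha)) :=
    LinearMap.isUnit_det _ ((Module.End.isUnit_iff _).2 hbij)
  have hquot : S.mapQ S A hS = hbc.endHom (N.mapQ N a ha) := by
    refine hbc.algHom_ext _ _ fun x => ?_
    obtain ⟨m, rfl⟩ := N.mkQ_surjective x
    rw [hbc.endHom_comp_apply]
    exact congrArg S.mkQ (hA m)
  have hdet : |LinearMap.det (S.mapQ S A hS)| = 1 := by
    rw [hquot, IsBaseChange.det_endHom]
    rcases Int.isUnit_iff.1 hunit with h | h <;> simp [h]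
  rw [LinearMap.det_eq_det_mul_det S A hS, abs_mul, hdet, mul_one]

namespace ToralEndo

variable {n : ℕ}

theorem isBaseChange_latticeEmb (n : ℕ) : IsBaseChange ℝ (latticeEmb n).toIntLinearMap := by
  have h : (latticeEmb n).toIntLinearMap =
      Fintype.linearCombination ℤ (Pi.basisFun ℝ (Fin n)) :=
    LinearMap.ext fun m => (IsBaseChange.of_fintype_basis_eq.2 rfl).symm
  rw [h]
  exact IsBaseChange.of_fintype_basis ℤ (Pi.basisFun ℝ (Fin n))

theorem linearPartReal_latticeEmb (f : C(Torus n, Torus n)) (m : Fin n → ℤ) :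
    linearPartReal f (latticeEmb n m) = latticeEmb n (piOneMap f m) := by
  have h : (linearPart f).mulVec m = piOneMap f m := by
    rw [← Matrix.toLin'_apply, linearPart, Matrix.toLin'_toMatrix']; rfl
  rw [← h]
  ext i
  simp [linearPartReal, latticeEmb, Matrix.mulVec, dotProduct]

theorem det_linearPartReal (f : C(Torus n, Torus n)) :
    LinearMap.det (linearPartReal f) = ((linearPart f).det : ℝ) := by
  rw [linearPartReal, LinearMap.det_toLin']
  exact ((Int.castRingHom ℝ).map_det _).symm

end ToralEndo

theorem mainTheorem7 (n : ℕ) (f : C(ToralEndo.Torus n, ToralEndo.Torus n))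
    (hf : ToralEndo.IsToralEndomorphism f) (hvol : ToralEndo.IsVolumePreserving f)
    (U : Set (ToralEndo.Torus n)) (hU : ToralEndo.IsInvariantRegion f U)
    (hconn : IsConnected U) (x : U) :
    ∃ hS : ∀ v ∈ ToralEndo.piOneSpan U x,
        ToralEndo.linearPartReal f v ∈ ToralEndo.piOneSpan U x,
      |LinearMap.det ((ToralEndo.linearPartReal f).restrict hS)| =
        |((ToralEndo.linearPart f).det : ℝ)| := by
  have hspan : ToralEndo.piOneSpan U x = Submodule.span ℝ
      ((ToralEndo.latticeEmb n).toIntLinearMap '' (ToralEndo.inclPiOne U x).range) := by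
    rw [ToralEndo.piOneSpan, AddMonoidHom.coe_range, ← Set.range_comp]
    rfl
  rw [hspan, ← ToralEndo.det_linearPartReal]
  exact abs_det_restrict_span_eq (ToralEndo.isBaseChange_latticeEmb n)
    (ToralEndo.piOneMap f).toIntLinearMap _ (ToralEndo.linearPartReal_latticeEmb f) _
    (fun _ => ToralEndo.piOneMap_mem_range_inclPiOne hU hconn x)
    (ToralEndo.exists_sub_piOneMap_mem_range_inclPiOne hf.1 hU hconn x)
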